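/- Let $\Sigma=\{0,1\}$, and let $\langle\cdot,\cdot\rangle:\Sigma^*\times\Sigma^*\to\Sigma^*$ be a pairing function, that is, an injective function computable in polynomial time. A complexity class is any collection of subsets of $\Sigma^*$. For $A,B\subseteq\Sigma^*$ put $A\oplus B=\{x0 : x\in A\}\cup\{x1 : x\in B\}$, $A\times B=\{\langle x,y\rangle : x\in A\text{ and }y\in B\}$, and $\overline{A}=\Sigma^*\setminus A$. For complexity classes $\mathcal C$ and $\mathcal D$, let $\mathrm P^{\mathcal C:\mathcal D}$ be the class of all $L\subseteq\Sigma^*$ for which there are $C\in\mathcal C$, $D\in\mathcal D$ and a deterministic polynomial-time oracle Turing machine $M$ (whose polynomial time bound holds independently of the oracles) such that, with oracles $C$ and $D$, the machine $M$ on every input makes at most one query to $C$ followed by at most one query to $D$, and accepts exactly the strings in $L$. Theorem. Let $\mathcal C$ and $\mathcal D$ be complexity classes such that (1) $A\oplus B\in\mathcal C$ for all $A,B\in\mathcal C$ ($\mathcal C$ is closed under disjoint union); (2) $C\times D\in\mathcal C$ for all $C\in\mathcal C$ and $D\in\mathcal D$ ($\mathcal C$ "ands" $(\mathcal C,\mathcal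 D)$); and (3) $C\times D\in\mathcal C$ for all $C\in\mathcal C$ and all $D$ with $\overline{D}\in\mathcal D$ ($\mathcal C$ "ands" $(\mathcal C,\mathrm{co}\mathcal D)$). Then $\mathrm P^{\mathcal C:\mathcal D}\subseteq\mathrm P^{\mathcal D:\mathcal C}$. -/

import Mathlib

open Turing

/-! ### Deterministic multitape oracle Turing machines with two oracles

The tape alphabet is `Option Bool`: `some false`, `some true` are the symbols 0 and 1 and `none` is
the blank. Tapes are two-way infinite (`Turing.Tape`). -/

/-- The longest initial block of 0/1 symbols of a list of tape symbols. -/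
def bitPrefix : List (Option Bool) → List Bool
  | some b :: l => b :: bitPrefix l
  | _ => []

theorem bitPrefix_append_blanks (l : List (Option Bool)) (n : ℕ) :
    bitPrefix (l ++ List.replicate n default) = bitPrefix l := by
  induction l with
  | nil => cases n <;> rfl
  | cons a l ih =>
    cases a with
    | none => rfl
    | some b => exact congrArg (b :: ·) ih

/-- The string on a tape: the 0/1 symbols from the head (inclusive) rightwards, up to the first
blank. -/
def readBits (T : Tape (Option Bool)) : List Bool :=
  T.right₀.liftOn bitPrefix (by
    rintro a _ ⟨n, rfl⟩
    exact (bitPrefix_append_blanks a n).symm)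

/-- What a machine with tapes `K` and states `Q` does in a given state: halt and accept, halt and
reject, ask one of the two oracles and branch on the answer, or perform an ordinary
transition, which depends on the scanned symbols and determines the next state and, for each tape,
the symbol written and the move of the head (`none`: the head stays). -/
inductive Instr (K Q : Type) : Type
  | accept : Instr K Q
  | reject : Instr K Q
  | query (i : Fin 2) (yes no : Q) : Instr K Q
  | trans (δ : (K → Option Bool) → Q × (K → Option Bool × Option Dir)) : Instr K Q

/-- A deterministic multitape Turing machine with two oracles (number 0 and number 1). A query
to oracle `i` asks about the string on the tape `queryTape i`. -/
structure OracleTM where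
  /-- the finite set of tapes -/
  K : Type
  [finK : Finite K]
  /-- the finite set of states -/
  Q : Type
  [finQ : Finite Q]
  input : K
  queryTape : Fin 2 → K
  start : Q
  instr : Q → Instr K Q

namespace OracleTM

variable (M : OracleTM)

/-- Configurations. -/
structure Cfg where
  state : M.Q
  tape : M.K → Tape (Option Bool)

open Classical in
/-- The initial configuration: `w` is on the input tape, with the head on its first symbol, and all
other tapes are blank. -/
noncomputable def init (w : List (Option Bool)) : M.Cfg where
  state := M.start
  tape := fun k => if k = M.input then Tape.mk₁ w else Tape.mk₁ []

/-- The effect of an ordinary transition on one tape. -/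
def act (T : Tape (Option Bool)) (a : Option Bool × Option Dir) : Tape (Option Bool) :=
  match a.2 with
  | none => T.write a.1
  | some d => (T.write a.1).move d

open Classical in
/-- One step with the oracle sets `O 0` and `O 1`. A query takes one step and leaves the tapes
unchanged; a halted machine stays in its configuration. -/
noncomputable def next (O : Fin 2 → Set (List Bool)) (c : M.Cfg) : M.Cfg :=
  match M.instr c.state with
  | .accept => c
  | .reject => c
  | .query i yes no =>
      ⟨if readBits (c.tape (M.queryTape i)) ∈ O i then yes else no, c.tape⟩
  | .trans δ =>
      ⟨(δ fun k => (c.tape k).head).1,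
        fun k => act (c.tape k) ((δ fun k => (c.tape k).head).2 k)⟩

/-- The configuration after `t` steps with initial tape content `w`. -/
noncomputable def run (O : Fin 2 → Set (List Bool)) (w : List (Option Bool)) (t : ℕ) : M.Cfg :=
  (M.next O)^[t] (M.init w)

/-- The machine has halted in configuration `c`. -/
def Halted (c : M.Cfg) : Prop :=
  M.instr c.state = .accept ∨ M.instr c.state = .reject

/-- The machine runs in polynomial time: some polynomial, the same for all oracles, bounds the
number of steps until it halts, in terms of the length of the input string. -/
def PolyTime : Prop :=
  ∃ p : Polynomial ℕ, ∀ (O : Fin 2 → Set (List Bool)) (x : List Bool),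
    M.Halted (M.run O (x.map some) (p.eval x.length))

/-- The machine with oracles `O` accepts the input string `x`. -/
def Accepts (O : Fin 2 → Set (List Bool)) (x : List Bool) : Prop :=
  ∃ t, M.instr (M.run O (x.map some) t).state = .accept

/-- With oracles `O` and input string `x`, the machine queries oracle `i` in step `t`. -/
def QueriesAt (O : Fin 2 → Set (List Bool)) (x : List Bool) (t : ℕ) (i : Fin 2) : Prop :=
  ∃ yes no, M.instr (M.run O (x.map some) t).state = .query i yes no

/-- On every input, the machine with oracles `O` makes at most one query to oracle 0 followed by at
most one query to oracle 1: of any two queries, the earlier one is to oracle 0 and the later one is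
to oracle 1. -/
def OrderedQueries (O : Fin 2 → Set (List Bool)) : Prop :=
  ∀ x s t i j, s < t → M.QueriesAt O x s i → M.QueriesAt O x t j → i = 0 ∧ j = 1

end OracleTM

/-! ### Complexity classes: sets of languages over {0, 1} -/

/-- `P^{𝒞 : 𝒟}`: the languages accepted by a deterministic polynomial-time oracle machine that
makes at most one query to some `A ∈ 𝒞` followed by at most one query to some `B ∈ 𝒟`. -/
def POrdered (𝒞 𝒟 : Set (Set (List Bool))) : Set (Set (List Bool)) :=
  {L | ∃ A ∈ 𝒞, ∃ B ∈ 𝒟, ∃ M : OracleTM,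
    M.PolyTime ∧ M.OrderedQueries ![A, B] ∧ ∀ x, x ∈ L ↔ M.Accepts ![A, B] x}

/-- `co𝒞`, the class of the languages whose complement is in `𝒞`. -/
def coClass (𝒞 : Set (Set (List Bool))) : Set (Set (List Bool)) :=
  {L | Lᶜ ∈ 𝒞}

/-- The disjoint union `A ⊕ B = {x0 | x ∈ A} ∪ {x1 | x ∈ B}`. -/
def disjUnion (A B : Set (List Bool)) : Set (List Bool) :=
  {w | ∃ x ∈ A, w = x ++ [false]} ∪ {w | ∃ x ∈ B, w = x ++ [true]}

/-- `𝒞` is closed under disjoint union. -/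
def ClosedUnderDisjUnion (𝒞 : Set (Set (List Bool))) : Prop :=
  ∀ A ∈ 𝒞, ∀ B ∈ 𝒞, disjUnion A B ∈ 𝒞

/-- A pairing function on strings: an injective function of two strings that is computable in
polynomial time. The machine starts with `x`, a blank and `y` on its input tape, and halts with the
string `pair x y` on a designated output tape; empty oracles serve for a machine without oracles. -/
structure IsPairing (pair : List Bool → List Bool → List Bool) : Prop where
  injective : Function.Injective2 pair
  polyTime : ∃ (M : OracleTM) (out : M.K) (p : Polynomial ℕ), ∀ x y : List Bool,
    M.Halted (M.run (fun _ => ∅) (x.map some ++ none :: y.map some)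
      (p.eval (x.length + y.length))) ∧
    readBits ((M.run (fun _ => ∅) (x.map some ++ none :: y.map some)
      (p.eval (x.length + y.length))).tape out) = pair x y

/-- The Cartesian product `A × B = {⟨x, y⟩ | x ∈ A and y ∈ B}` with respect to a pairing
function. -/
def langProd (pair : List Bool → List Bool → List Bool) (A B : Set (List Bool)) :
    Set (List Bool) :=
  {w | ∃ x ∈ A, ∃ y ∈ B, w = pair x y}

/-- `𝒞` "ands" `(𝒞, 𝒟)`: the product of a language in `𝒞` and a language in `𝒟` is in `𝒞`. -/
def Ands (pair : List Bool → List Bool → List Bool) (𝒞 𝒟 : Set (Set (List Bool))) : Prop :=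
  ∀ A ∈ 𝒞, ∀ B ∈ 𝒟, langProd pair A B ∈ 𝒞

/-! Suppose that a machine asks `u` of `A ∈ 𝒞` and then a string of `B ∈ 𝒟` that depends on the
answer. The exchanged machine first pretends that `u ∉ A` and puts the resulting second query to
`B`; this yields `b₀`, the outcome in case `u ∉ A`. Without any oracle it finds the second query `v`
that follows the answer "yes" to `u`, and the outcomes `a₁` and `a₂` in the cases `v ∈ B` and `v ∉
B`. It remains to learn which case holds.

If `a₁ = a₂`, it suffices to ask whether `u ∈ A`. Otherwise, outcomes being bits, exactly one of
`a₁`, `a₂` equals `b₀`, so the true outcome differs from `b₀` in a single case: `u ∈ A` and `v ∈ B`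
if `b₀ = a₂`, and `u ∈ A` and `v ∉ B` if `b₀ = a₁`. Hence one query to a disjoint union of `A`, `A ×
B` and `A × Bᶜ` decides, and the hypotheses put this language in `𝒞`.

The time bound of the machine holds for all oracles, so simulations with guessed answers halt in
time. The order of queries is promised only for the true oracles; a simulation based on a wrong
guess may break it, so the number of queries is capped by the program itself.

Machines are assembled from programs whose specifications `Ensures` record time and queried oracles.
`simulate_ensures` covers the simulations, `run_congr_of_stopsAt` carries their outcomes over to the
true oracles, `resolve_ensures` is the case distinction on `a₁`, `a₂`, `b₀`, and `swap_ensures`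
combines them. -/

/-! ### Structured programs for multitape oracle machines -/

/-- What a program does in a given state, branching to the labels `R`: ask an oracle, or perform a
transition. -/
inductive Op (K R : Type) : Type
  | query (i : Fin 2) (yes no : R) : Op K R
  | trans (δ : (K → Option Bool) → R × (K → Option Bool × Option Dir)) : Op K R

namespace Op

variable {K R R' : Type}

def map (f : R → R') : Op K R → Op K R'
  | query i yes no => query i (f yes) (f no)
  | trans δ => trans fun h => ((δ h).1, (δ h).2).map f id

/-- The list of oracles that are queried. -/
def queries : Op K R → List (Fin 2)
  | query i _ _ => [i]
  | trans _ => []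

def toInstr : Op K R → Instr K R
  | query i yes no => .query i yes no
  | trans δ => .trans δ

open Classical in
noncomputable def exec (qt : Fin 2 → K) (O : Fin 2 → Set (List Bool))
    (T : K → Tape (Option Bool)) :
    Op K R → R × (K → Tape (Option Bool))
  | query i yes no => (if readBits (T (qt i)) ∈ O i then yes else no, T)
  | trans δ => ((δ fun k => (T k).head).1,
      fun k => OracleTM.act (T k) ((δ fun k => (T k).head).2 k))

theorem queries_map (f : R → R') (op : Op K R) : (op.map f).queries = op.queries := by
  cases op <;> rfl

theorem exec_map (f : R → R') (qt : Fin 2 → K) (O : Fin 2 → Set (List Bool))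
    (T : K → Tape (Option Bool)) (op : Op K R) :
    (op.map f).exec qt O T = ((op.exec qt O T).1, (op.exec qt O T).2).map f id := by
  cases op with
  | query i yes no =>
    simp only [map, exec, Prod.map, id]
    split <;> rfl
  | trans δ => rfl

end Op

/-- A finite-state program on the tapes `K` that eventually exits with a label in `X`. -/
structure TapeProgram (K X : Type) where
  Q : Type
  [finQ : Finite Q]
  start : Q
  op : Q → Op K (Q ⊕ X)

attribute [instance] TapeProgram.finQ

namespace TapeProgram

variable {K X Y S : Type}

/-- `p.Exec qt O q T t l x T'`: in state `q` with tapes `T`, the program `p` exits with label `x` and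
tapes `T'` after `t` steps, having queried the oracles in the list `l`. -/
inductive Exec (qt : Fin 2 → K) (O : Fin 2 → Set (List Bool)) (p : TapeProgram K X) :
    p.Q → (K → Tape (Option Bool)) → ℕ → List (Fin 2) → X → (K → Tape (Option Bool)) → Prop
  | exit {q T x T'} (h : (p.op q).exec qt O T = (Sum.inr x, T')) :
      Exec qt O p q T 1 (p.op q).queries x T'
  | cont {q T q₁ T₁ t l x T'} (h : (p.op q).exec qt O T = (Sum.inl q₁, T₁))
      (hr : Exec qt O p q₁ T₁ t l x T') :
      Exec qt O p q T (t + 1) ((p.op q).queries ++ l) x T'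

/-- Started on the tapes `T`, the program exits within `n` steps, and `Post` holds for the list of
queried oracles, the exit label and the final tapes. -/
def Ensures (qt : Fin 2 → K) (O : Fin 2 → Set (List Bool)) (p : TapeProgram K X)
    (T : K → Tape (Option Bool)) (n : ℕ)
    (Post : List (Fin 2) → X → (K → Tape (Option Bool)) → Prop) : Prop :=
  ∃ t ≤ n, ∃ l x T', p.Exec qt O p.start T t l x T' ∧ Post l x T'

/-- Sequential composition. -/
def bind [Finite X] (p : TapeProgram K X) (f : X → TapeProgram K Y) : TapeProgram K Y where
  Q := p.Q ⊕ Σ x, (f x).Q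
  start := Sum.inl p.start
  op := Sum.elim
    (fun q => (p.op q).map fun r => Sum.inl (r.map id fun x => ⟨x, (f x).start⟩))
    (fun s => ((f s.1).op s.2).map (Sum.map (fun q => Sum.inr ⟨s.1, q⟩) id))

/-- Perform the transition `δ s` in state `s` until it yields an exit label. -/
def loop [Finite S] (δ : S → (K → Option Bool) → (S ⊕ X) × (K → Option Bool × Option Dir)) (s : S) :
    TapeProgram K X where
  Q := S
  start := s
  op := fun s => .trans (δ s)

/-- Query oracle `i` and return the answer. -/
def ask (i : Fin 2) : TapeProgram K Bool where
  Q := Unit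
  start := ()
  op := fun _ => .query i (Sum.inr true) (Sum.inr false)

/-- The action that leaves the tapes unchanged. -/
def stay (h : K → Option Bool) : K → Option Bool × Option Dir := fun k => (h k, none)

/-- A single transition. -/
def step (δ : (K → Option Bool) → K → Option Bool × Option Dir) : TapeProgram K Unit :=
  loop (S := Unit) (fun _ h => (Sum.inr (), δ h)) ()

/-- Exit at once with label `x`. -/
def ret (x : X) : TapeProgram K X :=
  loop (S := Unit) (fun _ h => (Sum.inr x, stay h)) ()

theorem act_stay (T : Tape (Option Bool)) : OracleTM.act T (T.head, none) = T :=
  T.write_self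

/-! ### Proof rules for executions of programs -/

section Rules

variable {qt : Fin 2 → K} {O : Fin 2 → Set (List Bool)} {T : K → Tape (Option Bool)} {n m : ℕ}
  {Post Post' : List (Fin 2) → X → (K → Tape (Option Bool)) → Prop}

theorem Ensures.mono {p : TapeProgram K X} (h : p.Ensures qt O T n Post) (hn : n ≤ m)
    (hP : ∀ l x T', Post l x T' → Post' l x T') : p.Ensures qt O T m Post' := by
  obtain ⟨t, ht, l, x, T', he, hp⟩ := h
  exact ⟨t, ht.trans hn, l, x, T', he, hP _ _ _ hp⟩

theorem queries_bind_inr [Finite X] (p : TapeProgram K X) (f : X → TapeProgram K Y) {x : X}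
    (q : (f x).Q) : ((p.bind f).op (Sum.inr ⟨x, q⟩)).queries = ((f x).op q).queries :=
  Op.queries_map _ _

theorem queries_bind_inl [Finite X] (p : TapeProgram K X) (f : X → TapeProgram K Y) (q : p.Q) :
    ((p.bind f).op (Sum.inl q)).queries = (p.op q).queries :=
  Op.queries_map _ _

theorem Exec.bind_right [Finite X] {p : TapeProgram K X} {f : X → TapeProgram K Y} {x : X}
    {q : (f x).Q} {t l y T'} (h : (f x).Exec qt O q T t l y T') :
    (p.bind f).Exec qt O (Sum.inr ⟨x, q⟩) T t l y T' := by
  induction h with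
  | exit h =>
    rw [← queries_bind_inr p]
    refine Exec.exit ?_
    simp only [bind, Sum.elim_inr, Op.exec_map, h]
    rfl
  | cont h _ ih =>
    rw [← queries_bind_inr p]
    refine Exec.cont ?_ ih
    simp only [bind, Sum.elim_inr, Op.exec_map, h]
    rfl

/-- The exiting step of `p` leads directly to the start state of `f x`. Sequencing therefore costs
no step: times add and query lists concatenate. -/
theorem Exec.bind [Finite X] {p : TapeProgram K X} {f : X → TapeProgram K Y}
    {q : p.Q} {t l x T'} (h : p.Exec qt O q T t l x T') {t' l' y T''}
    (h' : (f x).Exec qt O (f x).start T' t' l' y T'') :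
    (p.bind f).Exec qt O (Sum.inl q) T (t + t') (l ++ l') y T'' := by
  induction h with
  | exit h =>
    rw [add_comm, ← queries_bind_inl p f]
    refine Exec.cont ?_ h'.bind_right
    simp only [TapeProgram.bind, Sum.elim_inl, Op.exec_map, h]
    rfl
  | cont h _ ih =>
    rw [add_right_comm, List.append_assoc, ← queries_bind_inl p f]
    refine Exec.cont ?_ (ih h')
    simp only [TapeProgram.bind, Sum.elim_inl, Op.exec_map, h]
    rfl

theorem Ensures.bind [Finite X] {p : TapeProgram K X} {f : X → TapeProgram K Y}
    {Post' : List (Fin 2) → Y → (K → Tape (Option Bool)) → Prop}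
    (h : p.Ensures qt O T n Post)
    (h' : ∀ l x T', Post l x T' →
      (f x).Ensures qt O T' m fun l' y T'' => Post' (l ++ l') y T'') :
    (p.bind f).Ensures qt O T (n + m) Post' := by
  obtain ⟨t, ht, l, x, T', he, hp⟩ := h
  obtain ⟨t', ht', l', y, T'', he', hp'⟩ := h' _ _ _ hp
  exact ⟨t + t', by omega, l ++ l', y, T'', he.bind he', hp'⟩

/-- Composition with a first program that asks no queries. -/
theorem Ensures.bind_silent [Finite X] {p : TapeProgram K X} {f : X → TapeProgram K Y}
    {R : X → (K → Tape (Option Bool)) → Prop}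
    {Post' : List (Fin 2) → Y → (K → Tape (Option Bool)) → Prop}
    (h : p.Ensures qt O T n fun l x T' => l = [] ∧ R x T')
    (h' : ∀ x T', R x T' → (f x).Ensures qt O T' m Post') :
    (p.bind f).Ensures qt O T (n + m) Post' :=
  h.bind fun l x T' ⟨hl, hR⟩ => by subst hl; exact h' x T' hR

theorem ensures_loop_exit [Finite S]
    {δ : S → (K → Option Bool) → (S ⊕ X) × (K → Option Bool × Option Dir)} {s : S} {x : X}
    {a : K → Option Bool × Option Dir} (hδ : δ s (fun k => (T k).head) = (Sum.inr x, a))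
    (hP : Post [] x fun k => OracleTM.act (T k) (a k)) :
    (loop δ s).Ensures qt O T (n + 1) Post := by
  refine ⟨1, by omega, _, x, _, Exec.exit (p := loop δ s) (q := s)
    (T' := fun k => OracleTM.act (T k) (a k)) ?_, hP⟩
  simp only [loop, Op.exec, hδ]

/-- An execution names its own initial state, so the start state stored in the program plays no
role. -/
theorem Exec.loop_start [Finite S]
    {δ : S → (K → Option Bool) → (S ⊕ X) × (K → Option Bool × Option Dir)} {s s' : S}
    {q : (loop (X := X) δ s').Q} {t l x T'}
    (h : (loop δ s').Exec qt O q T t l x T') : (loop δ s).Exec qt O q T t l x T' := by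
  induction h with
  | exit h => exact Exec.exit (p := loop δ s) h
  | cont h _ ih => exact Exec.cont (p := loop δ s) h ih

theorem ensures_loop_cont [Finite S]
    {δ : S → (K → Option Bool) → (S ⊕ X) × (K → Option Bool × Option Dir)} {s s' : S}
    {a : K → Option Bool × Option Dir} (hδ : δ s (fun k => (T k).head) = (Sum.inl s', a))
    (h : (loop δ s').Ensures qt O (fun k => OracleTM.act (T k) (a k)) n Post) :
    (loop δ s).Ensures qt O T (n + 1) Post := by
  obtain ⟨t, ht, l, x, T', he, hp⟩ := h
  refine ⟨t + 1, by omega, _, x, T', Exec.cont (p := loop δ s) (q := s)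
    (T₁ := fun k => OracleTM.act (T k) (a k)) ?_ he.loop_start, hp⟩
  simp only [loop, Op.exec, hδ]

theorem ensures_step {Post : List (Fin 2) → Unit → (K → Tape (Option Bool)) → Prop}
    {δ : (K → Option Bool) → K → Option Bool × Option Dir}
    (hP : Post [] () fun k => OracleTM.act (T k) (δ (fun k => (T k).head) k)) :
    (step δ).Ensures qt O T 1 Post :=
  ensures_loop_exit (n := 0) rfl hP

theorem ensures_ret {x : X} (hP : Post [] x T) : (ret x).Ensures qt O T 1 Post := by
  refine ensures_loop_exit (n := 0) rfl ?_
  simpa only [stay, act_stay] using hP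

open Classical in
theorem ensures_ask {i : Fin 2} {Post : List (Fin 2) → Bool → (K → Tape (Option Bool)) → Prop}
    (hP : Post [i] (decide (readBits (T (qt i)) ∈ O i)) T) :
    (ask i).Ensures qt O T 1 Post := by
  refine ⟨1, le_rfl, _, _, T, Exec.exit (p := ask i) (q := ()) ?_, hP⟩
  simp only [ask, Op.exec]
  split <;> simp_all

end Rules

/-! ### Compilation to oracle machines -/

/-- The machine that runs a program and accepts when the program returns `true`. -/
def toMachine [Finite K] (p : TapeProgram K Bool) (input : K) (qt : Fin 2 → K) : OracleTM where
  K := K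
  Q := p.Q ⊕ Bool
  input := input
  queryTape := qt
  start := Sum.inl p.start
  instr := Sum.elim (fun q => (p.op q).toInstr) fun b => if b then .accept else .reject

section Compile

variable [Finite K] {p : TapeProgram K Bool} {input : K} {qt : Fin 2 → K}
  {O : Fin 2 → Set (List Bool)} {T T' : K → Tape (Option Bool)} {t : ℕ} {l : List (Fin 2)} {b : Bool}

theorem next_toMachine (q : p.Q) (T : K → Tape (Option Bool)) :
    (p.toMachine input qt).next O ⟨Sum.inl q, T⟩ =
      ⟨((p.op q).exec qt O T).1, ((p.op q).exec qt O T).2⟩ := by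
  cases h : p.op q with
  | query i yes no =>
    simp only [OracleTM.next, toMachine, Sum.elim_inl, h, Op.toInstr, Op.exec]
    rfl
  | trans δ => simp only [OracleTM.next, toMachine, Sum.elim_inl, h, Op.toInstr, Op.exec]

theorem next_toMachine_halted (b : Bool) (T : K → Tape (Option Bool)) :
    (p.toMachine input qt).next O ⟨Sum.inr b, T⟩ = ⟨Sum.inr b, T⟩ := by
  cases b <;> simp [OracleTM.next, toMachine]

theorem iterate_toMachine_halted (b : Bool) (T : K → Tape (Option Bool)) (s : ℕ) :
    ((p.toMachine input qt).next O)^[s] ⟨Sum.inr b, T⟩ = ⟨Sum.inr b, T⟩ :=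
  Function.iterate_fixed (next_toMachine_halted b T) s

theorem Exec.iterate_next {q : p.Q} (h : p.Exec qt O q T t l b T') :
    ((p.toMachine input qt).next O)^[t] ⟨Sum.inl q, T⟩ = ⟨Sum.inr b, T'⟩ := by
  induction h with
  | exit h => rw [Function.iterate_one, next_toMachine, h]
  | cont h _ ih => rw [Function.iterate_succ_apply, next_toMachine, h]; exact ih

theorem queries_eq_of_toMachine_query {q : p.Q} {i : Fin 2} :
    (∃ yes no, (p.toMachine input qt).instr (Sum.inl q) = .query i yes no) →
      (p.op q).queries = [i] := by
  rintro ⟨yes, no, h⟩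
  cases hq : p.op q with
  | query j y n =>
    simp only [toMachine, Sum.elim_inl, hq, Op.toInstr] at h
    cases h
    rfl
  | trans δ => simp [toMachine, hq, Op.toInstr] at h

theorem toMachine_not_query {b : Bool} {i : Fin 2} :
    ¬ ∃ yes no, (p.toMachine input qt).instr (Sum.inr b) = .query i yes no := by
  cases b <;> simp [toMachine]

theorem Exec.mem_queries {q : p.Q} (h : p.Exec qt O q T t l b T') {s : ℕ} {i : Fin 2}
    (hq : ∃ yes no, (p.toMachine input qt).instr
      (((p.toMachine input qt).next O)^[s] ⟨Sum.inl q, T⟩).state = .query i yes no) : i ∈ l := by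
  induction h generalizing s with
  | exit h =>
    cases s with
    | zero => simp [queries_eq_of_toMachine_query hq]
    | succ s =>
      rw [Function.iterate_succ_apply, next_toMachine, h, iterate_toMachine_halted] at hq
      exact absurd hq toMachine_not_query
  | cont h _ ih =>
    cases s with
    | zero => simp [queries_eq_of_toMachine_query hq]
    | succ s =>
      rw [Function.iterate_succ_apply, next_toMachine, h] at hq
      exact List.mem_append_right _ (ih hq)

theorem Exec.pair_sublist {q : p.Q} (h : p.Exec qt O q T t l b T') {s u : ℕ} {i j : Fin 2}
    (hsu : s < u)
    (hi : ∃ yes no, (p.toMachine input qt).instr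
      (((p.toMachine input qt).next O)^[s] ⟨Sum.inl q, T⟩).state = .query i yes no)
    (hj : ∃ yes no, (p.toMachine input qt).instr
      (((p.toMachine input qt).next O)^[u] ⟨Sum.inl q, T⟩).state = .query j yes no) :
    [i, j].Sublist l := by
  -- The later query is located relative to the successor configuration, from which the rest of the
  -- execution starts.
  obtain ⟨u, rfl⟩ : ∃ v, u = v + 1 := ⟨u - 1, by omega⟩
  rw [Function.iterate_succ_apply, next_toMachine] at hj
  induction h generalizing s u with
  | exit h =>
    rw [h, iterate_toMachine_halted] at hj
    exact absurd hj toMachine_not_query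
  | cont h hr ih =>
    rw [h] at hj
    cases s with
    | zero =>
      rw [queries_eq_of_toMachine_query hi]
      exact (List.singleton_sublist.2 (hr.mem_queries hj)).cons_cons i
    | succ s =>
      obtain ⟨u, rfl⟩ : ∃ v, u = v + 1 := ⟨u - 1, by omega⟩
      rw [Function.iterate_succ_apply, next_toMachine, h] at hi
      rw [Function.iterate_succ_apply, next_toMachine] at hj
      exact (ih hi u (by omega) hj).trans (List.sublist_append_right _ _)

theorem polyTime_toMachine (P : Polynomial ℕ)
    (h : ∀ O x, p.Ensures qt O ((p.toMachine input qt).init (List.map some x)).tape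
      (P.eval x.length) fun _ _ _ => True) : (p.toMachine input qt).PolyTime := by
  refine ⟨P, fun O x => ?_⟩
  obtain ⟨t, ht, l, b, T', he, -⟩ := h O x
  obtain ⟨d, hd⟩ := Nat.exists_eq_add_of_le' ht
  have hrun : (p.toMachine input qt).run O (x.map some) (P.eval x.length) = ⟨Sum.inr b, T'⟩ := by
    rw [hd, OracleTM.run, Function.iterate_add_apply]
    exact (congrArg _ he.iterate_next).trans (iterate_toMachine_halted b T' d)
  rw [hrun]
  cases b <;> simp [OracleTM.Halted, toMachine]

theorem orderedQueries_toMachine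
    (h : ∀ x, ∃ n, p.Ensures qt O ((p.toMachine input qt).init (List.map some x)).tape n
      fun l _ _ => l.Sublist [0, 1]) : (p.toMachine input qt).OrderedQueries O := by
  intro x s u i j hsu hi hj
  obtain ⟨n, t, -, l, b, T', he, hl⟩ := h x
  have := (he.pair_sublist hsu hi hj).trans hl
  exact (by decide : ∀ i j : Fin 2, [i, j].Sublist [0, 1] → i = 0 ∧ j = 1) i j this

theorem accepts_toMachine_iff {x : List Bool} {n : ℕ} {φ : Prop}
    (h : p.Ensures qt O ((p.toMachine input qt).init (List.map some x)).tape n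
      fun _ b _ => b = true ↔ φ) : (p.toMachine input qt).Accepts O x ↔ φ := by
  obtain ⟨t, -, l, b, T', he, hb⟩ := h
  rw [← hb]
  have hrun : (p.toMachine input qt).run O (x.map some) t = ⟨Sum.inr b, T'⟩ := he.iterate_next
  constructor
  · rintro ⟨s, hs⟩
    -- The configurations at times `s` and `t` are both halted, hence fixed, so both coincide with
    -- the one at time `s + t`.
    have hts : (p.toMachine input qt).run O (x.map some) (s + t) = ⟨Sum.inr b, T'⟩ := by
      rw [OracleTM.run, Function.iterate_add_apply]
      exact (congrArg _ he.iterate_next).trans (iterate_toMachine_halted b T' s)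
    have hfix : (p.toMachine input qt).next O ((p.toMachine input qt).run O (x.map some) s) =
        (p.toMachine input qt).run O (x.map some) s := by
      simp only [OracleTM.next, hs]
    rw [add_comm, OracleTM.run, Function.iterate_add_apply] at hts
    have := (Function.iterate_fixed hfix t).symm.trans hts
    rw [this] at hs
    cases b
    · simp [toMachine] at hs
    · rfl
  · rintro rfl
    exact ⟨t, by rw [hrun]; simp [toMachine]⟩

end Compile

end TapeProgram

/-! ### Tapes -/

theorem Turing.Tape.mk₂_move_right (L R : List (Option Bool)) (a : Option Bool) :
    (Tape.mk₂ L (a :: R)).move Dir.right = Tape.mk₂ (a :: L) R := by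
  simp [Tape.mk₂]

theorem Turing.Tape.mk₂_move_left (L R : List (Option Bool)) (a : Option Bool) :
    (Tape.mk₂ (a :: L) R).move Dir.left = Tape.mk₂ L (a :: R) := by
  simp [Tape.mk₂]

theorem Turing.Tape.mk₂_write_cons (L R : List (Option Bool)) (a b : Option Bool) :
    (Tape.mk₂ L (a :: R)).write b = Tape.mk₂ L (b :: R) := by
  simp [Tape.mk₂]

theorem Turing.Tape.mk₂_write_nil (L : List (Option Bool)) (b : Option Bool) :
    (Tape.mk₂ L []).write b = Tape.mk₂ L [b] := by
  simp [Tape.mk₂]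

theorem Turing.ListBlank.mk_nil_eq : ListBlank.mk [] = ListBlank.mk [(none : Option Bool)] :=
  Quotient.sound' (Or.inl ⟨1, rfl⟩)

/-- Makes explicit the blank to the left of the content, at which `seekBlank` stops. -/
theorem Turing.Tape.mk₂_nil_left (R : List (Option Bool)) :
    Tape.mk₂ [] R = Tape.mk₂ [none] R := by
  simp only [Tape.mk₂, ListBlank.mk_nil_eq]

theorem Turing.Tape.mk₂_head_cons (L R : List (Option Bool)) (a : Option Bool) :
    (Tape.mk₂ L (a :: R)).head = a := by
  simp [Tape.mk₂]

theorem act_mk₂_nil (L : List (Option Bool)) (a : Option Bool) :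
    OracleTM.act (Tape.mk₂ L []) (a, some Dir.right) = Tape.mk₂ (a :: L) [] := by
  simp only [OracleTM.act, Tape.mk₂_write_nil, Tape.mk₂_move_right]

theorem act_move (T : Tape (Option Bool)) (d : Dir) :
    OracleTM.act T (T.head, some d) = T.move d := by
  simp only [OracleTM.act, Tape.write_self]

theorem readBits_mk₂ (L R : List (Option Bool)) : readBits (Tape.mk₂ L R) = bitPrefix R := by
  simp only [readBits, Tape.mk₂, Tape.mk'_right₀]
  rfl

theorem exists_eq_mk₂ (T : Tape (Option Bool)) : ∃ L R, T = Tape.mk₂ L R := by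
  obtain ⟨L, R, rfl⟩ := T.exists_mk'
  induction L using ListBlank.induction_on with
  | _ L =>
    induction R using ListBlank.induction_on with
    | _ R => exact ⟨L, R, rfl⟩

theorem head_of_readBits_nil {T : Tape (Option Bool)} (h : readBits T = []) : T.head = none := by
  obtain ⟨L, R, rfl⟩ := exists_eq_mk₂ T
  rw [readBits_mk₂] at h
  match R, h with
  | [], _ => rfl
  | none :: _, _ => rfl

theorem head_of_readBits_cons {T : Tape (Option Bool)} {b : Bool} {w : List Bool}
    (h : readBits T = b :: w) : T.head = some b ∧ readBits (T.move Dir.right) = w := by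
  obtain ⟨L, R, rfl⟩ := exists_eq_mk₂ T
  rw [readBits_mk₂] at h
  match R, h with
  | some c :: R, h =>
    rw [Tape.mk₂_head_cons, Tape.mk₂_move_right, readBits_mk₂]
    simpa [bitPrefix] using h

theorem bitPrefix_map_some (w : List Bool) : bitPrefix (w.map some) = w := by
  induction w with
  | nil => rfl
  | cons b w ih => exact congrArg (b :: ·) ih

theorem length_bitPrefix_le (l : List (Option Bool)) : (bitPrefix l).length ≤ l.length := by
  induction l with
  | nil => exact le_rfl
  | cons a l ih =>
    cases a with
    | none => exact Nat.zero_le _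
    | some b => exact Nat.succ_le_succ ih

/-- The nonblank part of the tape, together with the head position, fits into `n` cells. -/
def FitsIn (n : ℕ) (T : Tape (Option Bool)) : Prop :=
  ∃ L R, T = Tape.mk₂ L R ∧ L.length + R.length ≤ n

theorem FitsIn.length_readBits_le {n : ℕ} {T : Tape (Option Bool)} (h : FitsIn n T) :
    (readBits T).length ≤ n := by
  obtain ⟨L, R, rfl, h⟩ := h
  rw [readBits_mk₂]
  have := length_bitPrefix_le R
  omega

theorem FitsIn.mono {n m : ℕ} {T : Tape (Option Bool)} (h : FitsIn n T) (hm : n ≤ m) :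
    FitsIn m T := by
  obtain ⟨L, R, hT, h⟩ := h
  exact ⟨L, R, hT, h.trans hm⟩

/-- Writing beyond the right end may add one cell, and moving beyond the left end another. -/
theorem FitsIn.act {n : ℕ} {T : Tape (Option Bool)} (h : FitsIn n T)
    (a : Option Bool × Option Dir) : FitsIn (n + 2) (OracleTM.act T a) := by
  obtain ⟨L, R, rfl, h⟩ := h
  obtain ⟨R', hR', hw⟩ : ∃ R', R'.length ≤ R.length ∧
      (Tape.mk₂ L R).write a.1 = Tape.mk₂ L (a.1 :: R') := by
    cases R with
    | nil => exact ⟨[], le_rfl, Tape.mk₂_write_nil _ _⟩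
    | cons b R => exact ⟨R, by simp, Tape.mk₂_write_cons _ _ _ _⟩
  obtain ⟨a₁, d⟩ := a
  simp only [OracleTM.act]
  rw [hw]
  match d with
  | none => exact ⟨_, _, rfl, by simp; omega⟩
  | some .right => exact ⟨_, _, Tape.mk₂_move_right _ _ _, by simp; omega⟩
  | some .left =>
    cases L with
    | nil =>
      dsimp only
      rw [Tape.mk₂_nil_left, Tape.mk₂_move_left]
      exact ⟨_, _, rfl, by simp at h ⊢; omega⟩
    | cons c L => exact ⟨_, _, Tape.mk₂_move_left _ _ _, by simp at h ⊢; omega⟩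

namespace TapeProgram

variable {K X : Type}

/-! ### Basic tape routines -/

open Classical in
/-- Write `a` on all tapes in `D` and move their heads to the right. -/
noncomputable def put (D : Set K) (a : Option Bool) : TapeProgram K Unit :=
  step fun h k => if k ∈ D then (a, some Dir.right) else (h k, none)

open Classical in
/-- Move the heads of the tapes in `D`. -/
noncomputable def shift (D : Set K) (d : Dir) : TapeProgram K Unit :=
  step fun h k => if k ∈ D then (h k, some d) else (h k, none)

open Classical in
/-- Copy the string on the tape `src` to all tapes in `D`. -/
noncomputable def copy (src : K) (D : Set K) : TapeProgram K Unit :=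
  loop (S := Unit) (fun _ h => match h src with
    | none => (Sum.inr (), stay h)
    | some b => (Sum.inl (), fun k => if k ∈ D then (some b, some Dir.right)
        else if k = src then (h k, some Dir.right) else (h k, none))) ()

open Classical in
/-- Move the heads of the tapes in `D` to the left until the one on the tape `k₀` is on a blank. -/
noncomputable def seekBlank (k₀ : K) (D : Set K) : TapeProgram K Unit :=
  loop (S := Unit) (fun _ h => match h k₀ with
    | none => (Sum.inr (), stay h)
    | some _ => (Sum.inl (), fun k => if k ∈ D then (h k, some Dir.left) else (h k, none))) ()

/-- Move the heads of the tapes in `D` at least one cell to the left, until the one on the tape `k₀`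
is on a blank. -/
noncomputable def rewind (k₀ : K) (D : Set K) : TapeProgram K Unit :=
  (shift D Dir.left).bind fun _ => seekBlank k₀ D

section Specs

variable {qt : Fin 2 → K} {O : Fin 2 → Set (List Bool)} {D : Set K} {k₀ src : K}

theorem put_ensures (T : K → Tape (Option Bool)) (a : Option Bool) (L : List (Option Bool))
    (hL : ∀ k ∈ D, T k = Tape.mk₂ L []) :
    (put D a).Ensures qt O T 1 fun l _ T' => l = [] ∧ (∀ k ∈ D, T' k = Tape.mk₂ (a :: L) []) ∧
      ∀ k ∉ D, T' k = T k := by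
  refine ensures_step ⟨rfl, fun k hk => ?_, fun k hk => ?_⟩
  · simp only [if_pos hk, hL k hk, act_mk₂_nil]
  · simp only [if_neg hk, act_stay]

theorem shift_ensures (T : K → Tape (Option Bool)) (d : Dir) :
    (shift D d).Ensures qt O T 1 fun l _ T' => l = [] ∧ (∀ k ∈ D, T' k = (T k).move d) ∧
      ∀ k ∉ D, T' k = T k := by
  refine ensures_step ⟨rfl, fun k hk => ?_, fun k hk => ?_⟩
  · simp only [if_pos hk, act_move]
  · simp only [if_neg hk, act_stay]

open Classical in
theorem copy_ensures (hsrc : src ∉ D) (w : List Bool) (T : K → Tape (Option Bool))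
    (hw : readBits (T src) = w) (L : List (Option Bool)) (hL : ∀ k ∈ D, T k = Tape.mk₂ L []) :
    (copy src D).Ensures qt O T (w.length + 1) fun l _ T' => l = [] ∧
      (∀ k ∈ D, T' k = Tape.mk₂ ((w.map some).reverse ++ L) []) ∧
      ∀ k ∉ D, k ≠ src → T' k = T k := by
  induction w generalizing T L with
  | nil =>
    refine ensures_loop_exit (x := ()) (a := stay fun k => (T k).head) ?_ ?_
    · simp only [head_of_readBits_nil hw]
    · simp only [stay, act_stay]
      exact ⟨trivial, hL, fun _ _ _ => trivial⟩
  | cons b w ih =>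
    obtain ⟨hb, hw'⟩ := head_of_readBits_cons hw
    refine ensures_loop_cont (s' := ()) (a := fun k => if k ∈ D then (some b, some Dir.right)
        else if k = src then ((T k).head, some Dir.right) else ((T k).head, none))
      ?_ ((ih _ ?_ (some b :: L) ?_).mono le_rfl ?_)
    · simp only [hb]
    · simp only [if_neg hsrc, if_true, act_move, hw']
    · intro k hk
      simp only [if_pos hk, hL k hk, act_mk₂_nil]
    · rintro l - T' ⟨rfl, h₁, h₂⟩
      refine ⟨rfl, fun k hk => by simp [h₁ k hk], fun k hk hks => ?_⟩
      rw [h₂ k hk hks]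
      simp only [if_neg hk, if_neg hks, act_stay]

open Classical in
-- The tapes are described with a move to the left just made, so that the scanned cell is a bit or
-- the final blank and the induction on `w` has a uniform hypothesis.
theorem seekBlank_ensures (hk₀ : k₀ ∈ D) (w : List Bool) (T : K → Tape (Option Bool))
    (L R : List (Option Bool))
    (hT : ∀ k ∈ D, T k = (Tape.mk₂ (w.map some ++ none :: L) R).move Dir.left) :
    (seekBlank k₀ D).Ensures qt O T (w.length + 1) fun l _ T' => l = [] ∧
      (∀ k ∈ D, T' k = Tape.mk₂ L (none :: ((w.map some).reverse ++ R))) ∧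
      ∀ k ∉ D, T' k = T k := by
  induction w generalizing T R with
  | nil =>
    simp only [List.map_nil, List.nil_append, Tape.mk₂_move_left] at hT
    refine ensures_loop_exit (x := ()) (a := stay fun k => (T k).head) ?_ ?_
    · simp only [hT k₀ hk₀, Tape.mk₂_head_cons]
    · simp only [stay, act_stay]
      exact ⟨trivial, hT, fun _ _ => trivial⟩
  | cons b w ih =>
    simp only [List.map_cons, List.cons_append, Tape.mk₂_move_left] at hT
    refine ensures_loop_cont (s' := ())
      (a := fun k => if k ∈ D then ((T k).head, some Dir.left) else ((T k).head, none))
      ?_ ((ih _ (some b :: R) ?_).mono le_rfl ?_)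
    · simp only [hT k₀ hk₀, Tape.mk₂_head_cons]
    · intro k hk
      simp only [if_pos hk, act_move, hT k hk]
    · rintro l - T' ⟨rfl, h₁, h₂⟩
      refine ⟨rfl, fun k hk => by simp [h₁ k hk], fun k hk => ?_⟩
      rw [h₂ k hk]
      simp only [if_neg hk, act_stay]

theorem rewind_ensures (hk₀ : k₀ ∈ D) (w : List Bool) (T : K → Tape (Option Bool))
    (L R : List (Option Bool))
    (hT : ∀ k ∈ D, T k = Tape.mk₂ ((w.map some).reverse ++ none :: L) R) :
    (rewind k₀ D).Ensures qt O T (w.length + 2) fun l _ T' => l = [] ∧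
      (∀ k ∈ D, T' k = Tape.mk₂ L (none :: (w.map some ++ R))) ∧ ∀ k ∉ D, T' k = T k := by
  refine Ensures.mono (Ensures.bind_silent (shift_ensures T Dir.left) fun _ T₁ hT₁ =>
    (seekBlank_ensures hk₀ w.reverse T₁ L R fun k hk => ?_).mono le_rfl ?_)
    (by simp only [List.length_reverse]; omega) fun _ _ _ h => h
  · rw [hT₁.1 k hk, hT k hk, List.map_reverse]
  · rintro l - T₂ ⟨rfl, h₁, h₂⟩
    refine ⟨rfl, fun k hk => by simp [h₁ k hk], fun k hk => by rw [h₂ k hk, hT₁.2 k hk]⟩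

end Specs

/-- Copy the string on the tape `src` to the blank tapes in `D`, one of which is `k₀`, leaving their
heads on the first symbol. -/
noncomputable def duplicate (src k₀ : K) (D : Set K) : TapeProgram K Unit :=
  (copy src D).bind fun _ => (rewind k₀ D).bind fun _ => shift D Dir.right

/-- Write the strings on `src₁` and `src₂`, separated by a blank, on the blank tape `dst`. -/
noncomputable def juxtapose (src₁ src₂ dst : K) : TapeProgram K Unit :=
  (copy src₁ {dst}).bind fun _ => (put {dst} none).bind fun _ => (copy src₂ {dst}).bind fun _ =>
    (rewind dst {dst}).bind fun _ => (rewind dst {dst}).bind fun _ => shift {dst} Dir.right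

/-- Query oracle `i` about the string on `src` followed by the bits `a` and `b`, using the blank query
tape `dst`. -/
noncomputable def askTagged (i : Fin 2) (src dst : K) (a b : Bool) : TapeProgram K Bool :=
  (copy src {dst}).bind fun _ => (put {dst} (some a)).bind fun _ => (put {dst} (some b)).bind fun _ =>
    (rewind dst {dst}).bind fun _ => (shift {dst} Dir.right).bind fun _ => ask i

section Specs

variable {qt : Fin 2 → K} {O : Fin 2 → Set (List Bool)} {D : Set K}

theorem duplicate_ensures {src k₀ : K} (hsrc : src ∉ D) (hk₀ : k₀ ∈ D) (w : List Bool)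
    (T : K → Tape (Option Bool)) (hw : readBits (T src) = w)
    (hD : ∀ k ∈ D, T k = Tape.mk₁ []) :
    (duplicate src k₀ D).Ensures qt O T (2 * w.length + 4) fun l _ T' => l = [] ∧
      (∀ k ∈ D, T' k = Tape.mk₁ (w.map some)) ∧ ∀ k ∉ D, k ≠ src → T' k = T k := by
  refine Ensures.mono (Ensures.bind_silent (copy_ensures hsrc w T hw [none] ?_) fun _ T₁ h₁ =>
    Ensures.bind_silent (rewind_ensures hk₀ w T₁ [] [] h₁.1) fun _ T₂ h₂ =>
    (shift_ensures T₂ Dir.right).mono le_rfl ?_) (by omega) fun _ _ _ h => h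
  · intro k hk
    rw [hD k hk, Tape.mk₁, Tape.mk₂_nil_left]
  · rintro l - T₃ ⟨rfl, h₃, h₃'⟩
    refine ⟨rfl, fun k hk => ?_, fun k hk hks => ?_⟩
    · rw [h₃ k hk, h₂.1 k hk, Tape.mk₂_move_right, ← Tape.mk₂_nil_left, List.append_nil, Tape.mk₁]
    · rw [h₃' k hk, h₂.2 k hk, h₁.2 k hk hks]

theorem juxtapose_ensures {src₁ src₂ dst : K} (hs₁ : src₁ ≠ dst) (hs₂ : src₂ ≠ dst) (h₁₂ : src₂ ≠ src₁)
    (u v : List Bool) (T : K → Tape (Option Bool)) (hu : readBits (T src₁) = u)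
    (hv : readBits (T src₂) = v) (hdst : T dst = Tape.mk₁ []) :
    (juxtapose src₁ src₂ dst).Ensures qt O T (2 * u.length + 2 * v.length + 8) fun l _ T' =>
      l = [] ∧ T' dst = Tape.mk₁ (u.map some ++ none :: v.map some) ∧
      ∀ k, k ≠ dst → k ≠ src₁ → k ≠ src₂ → T' k = T k := by
  refine Ensures.mono (Ensures.bind_silent
    (copy_ensures (D := {dst}) hs₁ u T hu [none] ?_) fun _ T₁ h₁ =>
    Ensures.bind_silent (put_ensures (D := {dst}) T₁ none _ h₁.1) fun _ T₂ h₂ =>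
    Ensures.bind_silent (copy_ensures (D := {dst}) hs₂ v T₂ ?_ _ h₂.1) fun _ T₃ h₃ =>
    -- This rewind ends on the separating blank; the next one leaves it, since a rewind moves at
    -- least one cell.
    Ensures.bind_silent (rewind_ensures (D := {dst}) rfl v T₃ _ [] h₃.1) fun _ T₄ h₄ =>
    Ensures.bind_silent (rewind_ensures (D := {dst}) rfl u T₄ [] _ h₄.1) fun _ T₅ h₅ =>
    (shift_ensures (D := {dst}) T₅ Dir.right).mono le_rfl ?_) (by omega) fun _ _ _ h => h
  · rintro k rfl
    rw [hdst, Tape.mk₁, Tape.mk₂_nil_left]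
  · rw [h₂.2 _ hs₂, h₁.2 _ hs₂ h₁₂, hv]
  · rintro l - T₆ ⟨rfl, h₆, h₆'⟩
    refine ⟨rfl, ?_, fun k hk hk₁ hk₂ => ?_⟩
    · rw [h₆ _ rfl, h₅.1 _ rfl, Tape.mk₂_move_right, ← Tape.mk₂_nil_left, List.append_nil, Tape.mk₁]
    · rw [h₆' k hk, h₅.2 k hk, h₄.2 k hk, h₃.2 k hk hk₂, h₂.2 k hk, h₁.2 k hk hk₁]

open Classical in
theorem askTagged_ensures {i : Fin 2} {src : K} (hsrc : src ≠ qt i) (a b : Bool) (w : List Bool)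
    (T : K → Tape (Option Bool)) (hw : readBits (T src) = w) (hdst : T (qt i) = Tape.mk₁ []) :
    (askTagged i src (qt i) a b).Ensures qt O T (2 * w.length + 9) fun l c _ =>
      l = [i] ∧ c = decide (w ++ [a] ++ [b] ∈ O i) := by
  refine Ensures.mono (Ensures.bind_silent
    (copy_ensures (D := {qt i}) hsrc w T hw [none] ?_) fun _ T₁ h₁ =>
    Ensures.bind_silent (put_ensures (D := {qt i}) T₁ (some a) _ h₁.1) fun _ T₂ h₂ =>
    Ensures.bind_silent (put_ensures (D := {qt i}) T₂ (some b) _ h₂.1) fun _ T₃ h₃ =>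
    Ensures.bind_silent
      (rewind_ensures (D := {qt i}) rfl (w ++ [a] ++ [b]) T₃ [] [] ?_) fun _ T₄ h₄ =>
    Ensures.bind_silent (shift_ensures (D := {qt i}) T₄ Dir.right) fun _ T₅ h₅ =>
    ensures_ask ⟨rfl, ?_⟩) (by simp; omega) fun _ _ _ h => h
  · rintro k rfl
    rw [hdst, Tape.mk₁, Tape.mk₂_nil_left]
  · intro k hk
    simp [h₃.1 k hk]
  · rw [h₅.1 _ rfl, h₄.1 _ rfl, Tape.mk₂_move_right, readBits_mk₂, List.append_nil,
      bitPrefix_map_some]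

end Specs

end TapeProgram

/-! ### Simulation with predetermined answers -/

namespace OracleTM

variable (M : OracleTM)

/-- The machine, whose queries to oracle `i` are answered by `b` if `a i = some b`, halts in state `q`
or asks a query without a predetermined answer. -/
def Stopped (a : Fin 2 → Option Bool) (q : M.Q) : Prop :=
  match M.instr q with
  | .accept => True
  | .reject => True
  | .query i _ _ => a i = none
  | .trans _ => False

/-- The oracles `O` give the predetermined answers `a`. -/
def Consistent (a : Fin 2 → Option Bool) (O : Fin 2 → Set (List Bool)) : Prop :=
  ∀ i b, a i = some b → ∀ w, w ∈ O i ↔ b = true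

/-- With predetermined answers `a`, the machine started in `c` first stops in `c'`, after at most `n`
steps. -/
def StopsAt (a : Fin 2 → Option Bool) (c : M.Cfg) (n : ℕ) (c' : M.Cfg) : Prop :=
  M.Stopped a c'.state ∧ ∃ m ≤ n, ∀ O, Consistent a O →
    (M.next O)^[m] c = c' ∧ ∀ s < m, ¬ M.Stopped a ((M.next O)^[s] c).state

open Classical in
noncomputable def accepting (q : M.Q) : Bool := decide (M.instr q = .accept)

variable {M}

theorem Halted.next_eq {c : M.Cfg} (h : M.Halted c) (O : Fin 2 → Set (List Bool)) :
    M.next O c = c := by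
  rcases h with h | h <;> simp only [next, h]

theorem Halted.iterate_next_eq {c : M.Cfg} (h : M.Halted c) (O : Fin 2 → Set (List Bool)) (s : ℕ) :
    (M.next O)^[s] c = c :=
  Function.iterate_fixed (h.next_eq O) s

theorem Halted.run_eq {O : Fin 2 → Set (List Bool)} {w : List (Option Bool)} {t t' : ℕ}
    (h : M.Halted (M.run O w t)) (ht : t ≤ t') : M.run O w t' = M.run O w t := by
  obtain ⟨d, rfl⟩ := Nat.exists_eq_add_of_le' ht
  rw [run, Function.iterate_add_apply]
  exact h.iterate_next_eq O d

theorem Halted.stopped {c : M.Cfg} (h : M.Halted c) (a : Fin 2 → Option Bool) :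
    M.Stopped a c.state := by
  rcases h with h | h <;> simp only [Stopped, h]

theorem Stopped.halted_or {a : Fin 2 → Option Bool} {c : M.Cfg} (h : M.Stopped a c.state) :
    M.Halted c ∨ ∃ i yes no, M.instr c.state = .query i yes no ∧ a i = none := by
  unfold Stopped at h
  unfold Halted
  cases hq : M.instr c.state with
  | accept => simp
  | reject => simp
  | query i yes no =>
    rw [hq] at h
    exact Or.inr ⟨i, yes, no, rfl, h⟩
  | trans δ =>
    rw [hq] at h
    exact h.elim

theorem Halted.not_query {c : M.Cfg} (h : M.Halted c) {i : Fin 2} {yes no : M.Q} :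
    M.instr c.state ≠ .query i yes no := by
  rcases h with h | h <;> simp [h]

theorem accepts_iff {O : Fin 2 → Set (List Bool)} {x : List Bool} {t : ℕ}
    (h : M.Halted (M.run O (x.map some) t)) :
    M.Accepts O x ↔ M.accepting (M.run O (x.map some) t).state = true := by
  classical
  rw [accepting, decide_eq_true_iff]
  refine ⟨fun ⟨s, hs⟩ => ?_, fun h => ⟨t, h⟩⟩
  rcases le_total s t with hst | hst
  · rwa [Halted.run_eq (Or.inl hs) hst]
  · rwa [h.run_eq hst] at hs

theorem accepts_iff_of_stopsAt {a : Fin 2 → Option Bool} {O : Fin 2 → Set (List Bool)}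
    (hO : Consistent a O) {x : List Bool} {n : ℕ} {c : M.Cfg}
    (hc : M.StopsAt a (M.init (x.map some)) n c) (hh : M.Halted c) :
    M.Accepts O x ↔ M.accepting c.state = true := by
  obtain ⟨-, m, -, hm⟩ := hc
  have hr : M.run O (x.map some) m = c := (hm O hO).1
  rw [accepts_iff (t := m) (by rwa [hr]), hr]

theorem Stopped.halted_of_isSome {a : Fin 2 → Option Bool} (ha : ∀ i, a i ≠ none) {c : M.Cfg}
    (h : M.Stopped a c.state) : M.Halted c := by
  rcases h.halted_or with h | ⟨i, _, _, _, hi⟩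
  · exact h
  · exact absurd hi (ha i)

/-- Two runs can part only at a query, so it is enough to compare the answers along one of them. -/
theorem run_congr {O O' : Fin 2 → Set (List Bool)} {w : List (Option Bool)}
    (h : ∀ s i yes no, M.instr (M.run O w s).state = .query i yes no →
      (readBits ((M.run O w s).tape (M.queryTape i)) ∈ O i ↔
        readBits ((M.run O w s).tape (M.queryTape i)) ∈ O' i)) (t : ℕ) :
    M.run O w t = M.run O' w t := by
  induction t with
  | zero => rfl
  | succ t ih =>
    have h₁ : M.run O w (t + 1) = M.next O (M.run O w t) := Function.iterate_succ_apply' _ _ _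
    have h₂ : M.run O' w (t + 1) = M.next O' (M.run O' w t) := Function.iterate_succ_apply' _ _ _
    rw [h₁, h₂, ← ih]
    unfold next
    split <;> try rfl
    rename_i i yes no hq
    classical
    congr 1
    exact if_congr (h t i yes no hq) rfl rfl

theorem accepts_congr {O O' : Fin 2 → Set (List Bool)} {x : List Bool}
    (h : ∀ t, M.run O (x.map some) t = M.run O' (x.map some) t) :
    M.Accepts O x ↔ M.Accepts O' x := by
  simp only [Accepts, h]

/-- If at most one query without predetermined answer is made, and it is made in `c`, then it is
sufficient to know the answer to that query. -/
theorem run_congr_of_stopsAt {O O' : Fin 2 → Set (List Bool)} {a : Fin 2 → Option Bool} {j : Fin 2}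
    (hO : Consistent a O) (hOO' : ∀ i, i ≠ j → O i = O' i) (haj : a j = none) {x : List Bool} {n : ℕ}
    {c : M.Cfg} (hc : M.StopsAt a (M.init (x.map some)) n c)
    (hmem : ∀ yes no, M.instr c.state = .query j yes no →
      (readBits (c.tape (M.queryTape j)) ∈ O j ↔ readBits (c.tape (M.queryTape j)) ∈ O' j))
    (hone : ∀ s t i, s < t → a i = none → M.QueriesAt O x s i → M.QueriesAt O x t j → False)
    (t : ℕ) : M.run O (x.map some) t = M.run O' (x.map some) t := by
  obtain ⟨hfinal, m, -, hm⟩ := hc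
  obtain ⟨hr, hlt⟩ := hm O hO
  change M.run O (x.map some) m = c at hr
  refine run_congr (fun s i yes no hq => ?_) t
  by_cases hij : i = j
  · subst hij
    rcases lt_trichotomy s m with hs | rfl | hs
    -- Before step `m`, a query to `j` would already have stopped the machine.
    · refine absurd ?_ (hlt s hs)
      change M.Stopped a (M.run O (x.map some) s).state
      simp only [Stopped, hq, haj]
    · rw [hr] at hq ⊢
      exact hmem _ _ hq
    -- After step `m`, either the machine has halted in `c`, or the query in `c` was followed by a
    -- query to `j`.
    · exfalso
      rcases hfinal.halted_or with hh | ⟨i', y, n', hq', hi'⟩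
      · rw [← hr] at hh
        rw [hh.run_eq hs.le] at hq
        exact hh.not_query hq
      · exact hone m s i' hs hi' ⟨y, n', by rw [hr, hq']⟩ ⟨yes, no, hq⟩
  · rw [hOO' i hij]

/-- Bounds the lengths of query strings and of the output of the pairing machine, which enter the
time bound. -/
theorem fitsIn_run (O : Fin 2 → Set (List Bool)) (w : List (Option Bool)) (t : ℕ) (k : M.K) :
    FitsIn (w.length + 2 * t) ((M.run O w t).tape k) := by
  induction t with
  | zero =>
    simp only [run, Function.iterate_zero, id, init]
    split
    · exact ⟨[], w, rfl, by simp⟩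
    · exact ⟨[], [], rfl, by simp⟩
  | succ t ih =>
    have h₁ : M.run O w (t + 1) = M.next O (M.run O w t) := Function.iterate_succ_apply' _ _ _
    rw [h₁]
    unfold next
    split
    · exact ih.mono (by omega)
    · exact ih.mono (by omega)
    · exact ih.mono (by omega)
    · exact ih.act _

theorem StopsAt.fitsIn {a : Fin 2 → Option Bool} {x : List Bool} {n : ℕ}
    {c : M.Cfg} (hc : M.StopsAt a (M.init (x.map some)) n c) (k : M.K) :
    FitsIn (x.length + 2 * n) (c.tape k) := by
  classical
  obtain ⟨-, m, hmn, hm⟩ := hc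
  -- `StopsAt` speaks only of consistent oracles, so one has to be exhibited.
  have hr : M.run (fun i => {_w | a i = some true}) (x.map some) m = c :=
    (hm _ fun i b hb w => by simp [hb]).1
  rw [← hr]
  refine (fitsIn_run _ _ m k).mono ?_
  simp only [List.length_map]
  omega

end OracleTM

/-! ### Programs that simulate a machine -/

namespace TapeProgram

variable {K : Type}

/-- Simulate the machine `M` on the tapes in the range of `e`, with predetermined answers `a`, until
it stops; return the state in which it stops. -/
noncomputable def simulate (M : OracleTM) (e : M.K → K) (a : Fin 2 → Option Bool) (q : M.Q) :
    TapeProgram K M.Q :=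
  haveI := M.finQ
  loop (S := M.Q) (fun q h => match M.instr q with
    | .accept => (Sum.inr q, stay h)
    | .reject => (Sum.inr q, stay h)
    | .query i yes no => match a i with
      | none => (Sum.inr q, stay h)
      | some b => (Sum.inl (if b then yes else no), stay h)
    | .trans δ => (Sum.inl (δ fun k => h (e k)).1,
        Function.extend e (δ fun k => h (e k)).2 (stay h))) q

section Specs

variable {qt : Fin 2 → K} {O : Fin 2 → Set (List Bool)}

/-- `O₀` serves only to bound the time: up to the stop, all answers are predetermined, so the run is
the same for all consistent oracles. -/
theorem simulate_ensures {M : OracleTM} {e : M.K → K} (he : Function.Injective e)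
    {a : Fin 2 → Option Bool} {O₀ : Fin 2 → Set (List Bool)} (hO₀ : OracleTM.Consistent a O₀)
    (n : ℕ) (c : M.Cfg) (T : K → Tape (Option Bool)) (hT : ∀ k, T (e k) = c.tape k)
    (hn : M.Halted ((M.next O₀)^[n] c)) :
    (simulate M e a c.state).Ensures qt O T (n + 1) fun l q T' => l = [] ∧
      ∃ c', M.StopsAt a c n c' ∧ q = c'.state ∧ (∀ k, T' (e k) = c'.tape k) ∧
        ∀ k ∉ Set.range e, T' k = T k := by
  have := M.finQ
  induction n generalizing c T with
  | zero =>
    refine ensures_loop_exit (x := c.state) (a := stay fun k => (T k).head) ?_ ?_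
    · rcases hn with h | h <;> rw [Function.iterate_zero_apply] at h <;> simp only [h]
    · simp only [stay, act_stay]
      exact ⟨trivial, c, ⟨hn.stopped a, 0, le_rfl, fun O _ => ⟨rfl, by simp⟩⟩, rfl, hT,
        fun _ _ => trivial⟩
  | succ n ih =>
    by_cases hs : M.Stopped a c.state
    · refine ensures_loop_exit (x := c.state) (a := stay fun k => (T k).head) ?_ ?_
      · rcases hs.halted_or with (h | h) | ⟨i, yes, no, h, hi⟩ <;> simp only [h]
        rw [hi]
      · simp only [stay, act_stay]
        exact ⟨trivial, c, ⟨hs, 0, Nat.zero_le _, fun O _ => ⟨rfl, by simp⟩⟩, rfl, hT,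
          fun _ _ => trivial⟩
    · rw [Function.iterate_succ_apply] at hn
      -- One simulated step; `acts` imitates it on the range of `e` and leaves the other tapes
      -- alone.
      have key : ∃ acts, (∀ O, OracleTM.Consistent a O → M.next O c = M.next O₀ c) ∧
          (∀ k, OracleTM.act (T (e k)) (acts (e k)) = (M.next O₀ c).tape k) ∧
          (∀ k ∉ Set.range e, OracleTM.act (T k) (acts k) = T k) ∧
          (match M.instr c.state with
            | .accept => (Sum.inr c.state, stay fun k => (T k).head)
            | .reject => (Sum.inr c.state, stay fun k => (T k).head)
            | .query i yes no => match a i with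
              | none => (Sum.inr c.state, stay fun k => (T k).head)
              | some b => (Sum.inl (if b then yes else no), stay fun k => (T k).head)
            | .trans δ => (Sum.inl (δ fun k => (T (e k)).head).1,
                Function.extend e (δ fun k => (T (e k)).head).2 (stay fun k => (T k).head))) =
            ((Sum.inl (M.next O₀ c).state, acts) :
              (M.Q ⊕ M.Q) × (K → Option Bool × Option Dir)) := by
        cases hq : M.instr c.state with
        | accept => exact absurd (by simp only [OracleTM.Stopped, hq]) hs
        | reject => exact absurd (by simp only [OracleTM.Stopped, hq]) hs
        | query i yes no =>
          cases hi : a i with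
          | none => exact absurd (by simp only [OracleTM.Stopped, hq, hi]) hs
          | some b =>
            refine ⟨stay fun k => (T k).head, fun O hO => ?_, fun k => ?_, fun k _ => ?_, ?_⟩
            · simp only [OracleTM.next, hq, hO i b hi, hO₀ i b hi]
            · simp only [stay, act_stay, OracleTM.next, hq, hT]
            · simp only [stay, act_stay]
            · simp only [OracleTM.next, hq, hO₀ i b hi, hi]
        | trans δ =>
          refine ⟨Function.extend e (δ fun k => (T (e k)).head).2 (stay fun k => (T k).head),
            fun O hO => ?_, fun k => ?_, fun k hk => ?_, ?_⟩
          · simp only [OracleTM.next, hq]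
          · simp only [he.extend_apply, OracleTM.next, hq, hT]
          · rw [Function.extend_apply' _ _ _ hk, stay, act_stay]
          · simp only [OracleTM.next, hq, hT]
      obtain ⟨acts, hnext, htape, hframe, hδ⟩ := key
      refine ensures_loop_cont hδ ((ih (M.next O₀ c) _ htape hn).mono le_rfl ?_)
      rintro l q T' ⟨rfl, c', ⟨hst, m, hm, hO⟩, rfl, hT', hF⟩
      refine ⟨rfl, c', ⟨hst, m + 1, by omega, fun O hOa => ⟨?_, fun s hsm => ?_⟩⟩, rfl, hT',
        fun k hk => (hF k hk).trans (hframe k hk)⟩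
      · rw [Function.iterate_succ_apply, hnext O hOa, (hO O hOa).1]
      · cases s with
        | zero => exact hs
        | succ s =>
          rw [Function.iterate_succ_apply, hnext O hOa]
          exact (hO O hOa).2 s (by omega)

end Specs

/-- Run `M` with oracle 0 empty and at most one query to its oracle 1, which is answered by
oracle 0; return whether it accepts. -/
noncomputable def runWithoutFirst (M : OracleTM) (e : M.K → K) : TapeProgram K Bool :=
  haveI := M.finQ
  (simulate M e ![some false, none] M.start).bind fun q => match M.instr q with
    | .query _ yes no => (ask 0).bind fun b =>
        (simulate M e ![some false, none] (if b then yes else no)).bind fun q' =>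
          ret (M.accepting q')
    | _ => ret (M.accepting q)

/-- The bound on the query list needs no promise, because the second simulation stops at a further
query; only correctness needs that there is none. By `hqt`, the simulated query string already
stands on the real query tape. -/
theorem runWithoutFirst_ensures {M : OracleTM} {e : M.K → K} (he : Function.Injective e)
    {qt : Fin 2 → K} (hqt : qt 0 = e (M.queryTape 1)) (O : Fin 2 → Set (List Bool)) (x : List Bool)
    (n : ℕ) (T : K → Tape (Option Bool)) (hT : ∀ k, T (e k) = (M.init (x.map some)).tape k)
    (hn : ∀ O₀, M.Halted (M.run O₀ (x.map some) n)) :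
    (runWithoutFirst M e).Ensures qt O T (2 * n + 4) fun l b T' => l.Sublist [0] ∧
      ((∀ s t, s < t → M.QueriesAt ![∅, O 0] x s 1 → M.QueriesAt ![∅, O 0] x t 1 → False) →
        (b = true ↔ M.Accepts ![∅, O 0] x)) ∧ ∀ k ∉ Set.range e, T' k = T k := by
  have := M.finQ
  have hcons : OracleTM.Consistent ![some false, none] ![∅, O 0] := by
    intro i b hb w
    fin_cases i
    · obtain rfl : false = b := by simpa using hb
      simp
    · simp at hb
  refine Ensures.mono (n := n + 1 + (1 + (n + 1 + 1))) (Ensures.bind_silent (simulate_ensures he hcons n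
    (M.init (x.map some)) T hT (hn ![∅, O 0])) ?_) (by omega) fun _ _ _ h => h
  rintro q T₁ ⟨c, hc, rfl, hT₁, hF₁⟩
  obtain ⟨m, hmn, hm⟩ := hc.2
  have hr : M.run ![∅, O 0] (x.map some) m = c := (hm _ hcons).1
  by_cases hh : M.Halted c
  · have hm : (match M.instr c.state with
        | .query _ yes no => (ask 0).bind fun b =>
            (simulate M e ![some false, none] (if b then yes else no)).bind fun q' =>
              ret (M.accepting q')
        | _ => ret (M.accepting c.state)) = ret (K := K) (M.accepting c.state) := by
      rcases hh with h | h <;> simp only [h]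
    rw [hm]
    refine Ensures.mono (ensures_ret (Post := fun l b T' => l = [] ∧ b = M.accepting c.state ∧ T' = T₁)
      ⟨rfl, rfl, rfl⟩) (by omega) ?_
    rintro l b T' ⟨rfl, rfl, rfl⟩
    exact ⟨List.nil_sublist _, fun _ => (OracleTM.accepts_iff_of_stopsAt hcons hc hh).symm, hF₁⟩
  · obtain ⟨i, yes, no, hq, hi⟩ := hc.1.halted_or.resolve_left hh
    obtain rfl : i = 1 := by
      fin_cases i
      · simp at hi
      · rfl
    simp only [hq]
    refine (ensures_ask (Post := fun l b T' => l = [0] ∧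
      M.next ![∅, O 0] c = ⟨if b then yes else no, c.tape⟩ ∧ T₁ = T') ⟨rfl, ?_, rfl⟩).bind ?_
    · have hqT : T₁ (qt 0) = c.tape (M.queryTape 1) := by rw [hqt, hT₁]
      by_cases hb : readBits (c.tape (M.queryTape 1)) ∈ O 0 <;>
        simp [OracleTM.next, hq, hqT, hb]
    rintro _ b T₁' ⟨rfl, hnext, hTT⟩
    subst hTT
    -- The whole run halts within `n` steps, hence is still halted `n` steps after the query.
    have hhalt : M.Halted ((M.next ![∅, O 0])^[n] (M.next ![∅, O 0] c)) := by
      have h₁ := hn ![∅, O 0]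
      rw [← h₁.run_eq (t' := n + (m + 1)) (by omega)] at h₁
      rwa [OracleTM.run, Function.iterate_add_apply, Function.iterate_succ_apply',
        (hm _ hcons).1] at h₁
    rw [hnext] at hhalt
    refine Ensures.bind_silent (simulate_ensures he hcons n ⟨if b then yes else no, c.tape⟩ T₁ hT₁
      hhalt) ?_
    rintro q T₂ ⟨c', hc', rfl, hT₂, hF₂⟩
    refine ensures_ret ⟨by simp, fun hone => ?_, fun k hk => (hF₂ k hk).trans (hF₁ k hk)⟩
    obtain ⟨m', -, hm'⟩ := hc'.2
    have hr' : M.run ![∅, O 0] (x.map some) (m' + (m + 1)) = c' := by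
      rw [OracleTM.run, Function.iterate_add_apply, Function.iterate_succ_apply', (hm _ hcons).1,
        hnext, (hm' _ hcons).1]
    rcases hc'.1.halted_or with hh' | ⟨i, y, n', hq', hi'⟩
    · rw [OracleTM.accepts_iff (t := m' + (m + 1)) (by rwa [hr']), hr']
    · obtain rfl : i = 1 := by
        fin_cases i
        · simp at hi'
        · rfl
      exact (hone m (m' + (m + 1)) (by omega) ⟨_, _, by rw [hr, hq]⟩ ⟨_, _, by rw [hr', hq']⟩).elim

end TapeProgram

theorem Polynomial.eval_le_eval_nat (p : Polynomial ℕ) {m n : ℕ} (h : m ≤ n) :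
    p.eval m ≤ p.eval n := by
  rw [Polynomial.eval_eq_sum, Polynomial.eval_eq_sum]
  exact Finset.sum_le_sum fun i _ => Nat.mul_le_mul_left _ (Nat.pow_le_pow_left h i)

/-! ### Exchanging the order of two queries -/

/-- Tapes for five simulated copies of a machine with tapes `K`, for a pairing machine with tapes
`K'`, for the input and for a query. -/
inductive SwapTape (K K' : Type) : Type
  | copy (j : Fin 5) (k : K) : SwapTape K K'
  | pairing (k : K') : SwapTape K K'
  | input : SwapTape K K'
  | ask : SwapTape K K'

namespace SwapTape

variable {K K' : Type}

def toSum : SwapTape K K' → (Fin 5 × K) ⊕ (K' ⊕ Bool)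
  | copy j k => Sum.inl (j, k)
  | pairing k => Sum.inr (Sum.inl k)
  | input => Sum.inr (Sum.inr false)
  | ask => Sum.inr (Sum.inr true)

theorem toSum_injective : Function.Injective (toSum (K := K) (K' := K')) := by
  intro a b h
  cases a <;> cases b <;> simp_all [toSum]

instance [Finite K] [Finite K'] : Finite (SwapTape K K') :=
  Finite.of_injective _ toSum_injective

theorem copy_injective (j : Fin 5) : Function.Injective (copy j : K → SwapTape K K') := by
  intro a b h
  cases h
  rfl

theorem pairing_injective : Function.Injective (pairing : K' → SwapTape K K') := by
  intro a b h
  cases h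
  rfl

end SwapTape

/-- The language asked by the second query after the exchange. -/
def swapLang (pair : List Bool → List Bool → List Bool) (A B : Set (List Bool)) :
    Set (List Bool) :=
  -- Two tag bits are appended, the last one selecting the outer component. The repeated product
  -- gives every string exactly two tags.
  disjUnion (disjUnion A (langProd pair A B))
    (disjUnion (langProd pair A Bᶜ) (langProd pair A Bᶜ))

theorem append_false_mem_disjUnion {A B : Set (List Bool)} {x : List Bool} :
    x ++ [false] ∈ disjUnion A B ↔ x ∈ A := by
  simp [disjUnion]

theorem append_true_mem_disjUnion {A B : Set (List Bool)} {x : List Bool} :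
    x ++ [true] ∈ disjUnion A B ↔ x ∈ B := by
  simp [disjUnion]

theorem pair_mem_langProd {pair : List Bool → List Bool → List Bool}
    (hpair : Function.Injective2 pair) {A B : Set (List Bool)} {x y : List Bool} :
    pair x y ∈ langProd pair A B ↔ x ∈ A ∧ y ∈ B := by
  constructor
  · rintro ⟨u, hu, v, hv, h⟩
    obtain ⟨rfl, rfl⟩ := hpair h
    exact ⟨hu, hv⟩
  · rintro ⟨hx, hy⟩
    exact ⟨x, hx, y, hy, rfl⟩

namespace TapeProgram

section Swap

variable (M P : OracleTM) (out : P.K)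

/-- Given the outcome `b₀` if the first query is answered "no", and the outcomes `a₁` and `a₂` if the
first query is answered "yes" and the second one "yes" or "no", determine the actual outcome with
one query. -/
noncomputable def resolve (b₀ a₁ a₂ : Bool) : TapeProgram (SwapTape M.K P.K) Bool :=
  haveI := P.finQ
  if a₁ = a₂ then
    (askTagged 1 (.copy 0 (M.queryTape 0)) .ask false false).bind fun c =>
      ret (if c then a₁ else b₀)
  else
    (juxtapose (.copy 0 (M.queryTape 0)) (.copy 1 (M.queryTape 1)) (.pairing P.input)).bind fun _ =>
      -- Answering "no" throughout amounts to empty oracles.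
      (simulate P .pairing (fun _ => some false) P.start).bind fun _ =>
        -- The tags select `A × B` if `b₀ = a₂` and `A × Bᶜ` otherwise.
        (askTagged 1 (.pairing out) .ask (b₀ == a₂) (b₀ != a₂)).bind fun c =>
          ret (if c then !b₀ else b₀)

open Classical in
/-- The program that makes the queries of `M` in the opposite order. -/
noncomputable def swap : TapeProgram (SwapTape M.K P.K) Bool :=
  haveI := M.finQ
  (duplicate .input (.copy 0 M.input) {k | ∃ j, k = .copy j M.input}).bind fun _ =>
  (runWithoutFirst M (.copy 4)).bind fun b₀ =>
  (simulate M (.copy 0) (fun _ => none) M.start).bind fun q =>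
    -- Otherwise `M` halts without a query or asks oracle 1 first; in the latter case the order of
    -- queries excludes oracle 0 thereafter, and `b₀` is the true outcome.
    if ∃ yes no, M.instr q = .query 0 yes no then
      (simulate M (.copy 1) ![some true, none] M.start).bind fun _ =>
      (simulate M (.copy 2) ![some true, some true] M.start).bind fun q₁ =>
      (simulate M (.copy 3) ![some true, some false] M.start).bind fun q₂ =>
        resolve M P out b₀ (M.accepting q₁) (M.accepting q₂)
    else ret b₀

/-- The query tapes of `swap`. -/
def swapQueryTape : Fin 2 → SwapTape M.K P.K :=
  ![.copy 4 (M.queryTape 1), .ask]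

variable {M P out} {O : Fin 2 → Set (List Bool)} {pair : List Bool → List Bool → List Bool}

open Classical in
theorem resolve_ensures (hpair : Function.Injective2 pair) {r : Polynomial ℕ}
    (hr : ∀ x y : List Bool,
      P.Halted (P.run (fun _ => ∅) (x.map some ++ none :: y.map some)
        (r.eval (x.length + y.length))) ∧
      readBits ((P.run (fun _ => ∅) (x.map some ++ none :: y.map some)
        (r.eval (x.length + y.length))).tape out) = pair x y)
    (T : SwapTape M.K P.K → Tape (Option Bool)) (u v : List Bool)
    (hu : readBits (T (.copy 0 (M.queryTape 0))) = u)
    (hv : readBits (T (.copy 1 (M.queryTape 1))) = v)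
    (hpairing : ∀ k, T (.pairing k) = Tape.mk₁ []) (hask : T .ask = Tape.mk₁ []) (b₀ a₁ a₂ : Bool) :
    (resolve M P out b₀ a₁ a₂).Ensures (swapQueryTape M P) O T
      (4 * u.length + 4 * v.length + 5 * r.eval (u.length + v.length) + 21) fun l b _ =>
        l = [1] ∧ ∀ A B, O 1 = swapLang pair A B →
          b = if u ∈ A then (if v ∈ B then a₁ else a₂) else b₀ := by
  have := P.finQ
  unfold resolve
  split_ifs with h
  · subst h
    refine Ensures.mono (Ensures.bind (askTagged_ensures (qt := swapQueryTape M P) (i := 1)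
      (by simp [swapQueryTape]) false false u T hu hask) ?_) (m := _)
      (n := 2 * u.length + 9 + 1) (by omega) fun _ _ _ h => h
    rintro _ c T₁ ⟨rfl, rfl⟩
    refine ensures_ret ⟨rfl, fun A B hO => ?_⟩
    rw [hO, swapLang, append_false_mem_disjUnion, append_false_mem_disjUnion]
    by_cases hA : u ∈ A <;> simp [hA]
  -- The pairing machine cannot write more than its space allows; the 1 is the separating blank.
  · have hlen : (pair u v).length ≤ u.length + v.length + 1 + 2 * r.eval (u.length + v.length) := by
      rw [← (hr u v).2]
      refine ((OracleTM.fitsIn_run _ _ _ _).mono ?_).length_readBits_le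
      simp only [List.length_append, List.length_map, List.length_cons]
      omega
    refine Ensures.mono (Ensures.bind_silent (juxtapose_ensures (by simp) (by simp) (by simp) u v T
      hu hv (hpairing _)) fun _ T₁ h₁ => Ensures.bind_silent
      (simulate_ensures SwapTape.pairing_injective (O₀ := fun _ => ∅) (by simp [OracleTM.Consistent])
        (r.eval (u.length + v.length)) (P.init (u.map some ++ none :: v.map some)) T₁ ?_ (hr u v).1)
      fun q T₂ h₂ => Ensures.bind (askTagged_ensures (qt := swapQueryTape M P) (i := 1)
        (by simp [swapQueryTape]) _ _ (pair u v) T₂ ?_ ?_) ?_)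
      (m := _) (n := 2 * u.length + 2 * v.length + 8 + (r.eval (u.length + v.length) + 1 +
        (2 * (pair u v).length + 9 + 1))) (by omega) fun _ _ _ h => h
    · intro k
      by_cases hk : k = P.input
      · subst hk
        simp [OracleTM.init, h₁.1]
      · rw [h₁.2 _ (by simpa using hk) (by simp) (by simp), hpairing]
        simp [OracleTM.init, hk]
    · obtain ⟨c, ⟨hc, m, hm, hO⟩, -, hT₂, -⟩ := h₂
      have hc' := hc.halted_of_isSome (by simp)
      have hrun : P.run (fun _ => ∅) (u.map some ++ none :: v.map some) m = c :=
        (hO _ (by simp [OracleTM.Consistent])).1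
      rw [← hrun] at hc'
      rw [hT₂, ← (hr u v).2, hc'.run_eq hm, hrun]
    · obtain ⟨c, -, -, -, hF⟩ := h₂
      change T₂ .ask = _
      rw [hF _ (by simp), h₁.2 _ (by simp) (by simp) (by simp), hask]
    · rintro _ c T₃ ⟨rfl, rfl⟩
      refine ensures_ret ⟨rfl, fun A B hO => ?_⟩
      rw [hO, swapLang]
      by_cases hb : b₀ = a₂
      · obtain rfl : a₁ = !b₀ := by subst hb; revert h; cases a₁ <;> cases b₀ <;> simp
        subst hb
        simp only [beq_self_eq_true, bne_self_eq_false, append_false_mem_disjUnion,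
          append_true_mem_disjUnion, pair_mem_langProd hpair]
        by_cases hA : u ∈ A <;> by_cases hB : v ∈ B <;> simp [hA, hB]
      · obtain rfl : a₂ = !b₀ := by revert hb; cases a₂ <;> cases b₀ <;> simp
        obtain rfl : a₁ = b₀ := by revert h; cases a₁ <;> cases b₀ <;> simp
        have h₁ : (a₁ == !a₁) = false := by cases a₁ <;> rfl
        have h₂ : (a₁ != !a₁) = true := by cases a₁ <;> rfl
        simp only [h₁, h₂, append_false_mem_disjUnion, append_true_mem_disjUnion,
          pair_mem_langProd hpair]
        by_cases hA : u ∈ A <;> by_cases hB : v ∈ B <;> simp [hA, hB]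

/-- The time bound of `swap`, where `p` and `r` are time bounds of the machine and of the pairing
machine. -/
noncomputable def swapTime (p r : Polynomial ℕ) : Polynomial ℕ :=
  -- Both `u` and `v` have length at most `n + 2 * p n`. The factor 22 comprises 6 for simulating
  -- `M` and 16 for handling `u` and `v`.
  10 * Polynomial.X + 22 * p + 5 * r.comp (2 * (Polynomial.X + 2 * p)) + 33

theorem eval_swapTime (p r : Polynomial ℕ) (n : ℕ) :
    (swapTime p r).eval n = 10 * n + 22 * p.eval n + 5 * r.eval (2 * (n + 2 * p.eval n)) + 33 := by
  simp [swapTime]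

theorem consistent_univ {o : Option Bool} {B : Set (List Bool)}
    (h : ∀ b, o = some b → ∀ w, w ∈ B ↔ b = true) :
    OracleTM.Consistent ![some true, o] ![Set.univ, B] := by
  intro i b hb w
  fin_cases i
  · obtain rfl : true = b := by simpa using hb
    simp
  · exact h b hb w

open OracleTM in
theorem swap_ensures (hpair : Function.Injective2 pair) {p r : Polynomial ℕ}
    (hp : ∀ (O : Fin 2 → Set (List Bool)) (x : List Bool),
      M.Halted (M.run O (x.map some) (p.eval x.length)))
    (hr : ∀ x y : List Bool,
      P.Halted (P.run (fun _ => ∅) (x.map some ++ none :: y.map some)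
        (r.eval (x.length + y.length))) ∧
      readBits ((P.run (fun _ => ∅) (x.map some ++ none :: y.map some)
        (r.eval (x.length + y.length))).tape out) = pair x y)
    (x : List Bool) (T : SwapTape M.K P.K → Tape (Option Bool))
    (hin : T .input = Tape.mk₁ (x.map some)) (hT : ∀ k, k ≠ .input → T k = Tape.mk₁ []) :
    (swap M P out).Ensures (swapQueryTape M P) O T ((swapTime p r).eval x.length) fun l b _ =>
      l.Sublist [0, 1] ∧ ∀ A B, O = ![B, swapLang pair A B] → M.OrderedQueries ![A, B] →
        (b = true ↔ M.Accepts ![A, B] x) := by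
  classical
  have := M.finQ
  rw [eval_swapTime]
  set n := x.length with hn
  set N := p.eval n with hN
  have hdup := duplicate_ensures (qt := swapQueryTape M P) (O := O)
    (D := {k | ∃ j, k = .copy j M.input}) (src := .input) (k₀ := .copy 0 M.input) (by simp)
    ⟨0, rfl⟩ x T (by rw [hin, Tape.mk₁, readBits_mk₂, bitPrefix_map_some]) (by
      rintro _ ⟨j, rfl⟩
      exact hT _ (by simp))
  unfold swap
  refine Ensures.mono (n := 2 * n + 4 + (2 * N + 4 + (N + 1 + (N + 1 + (N + 1 + (N + 1 +
    (8 * (n + 2 * N) + 5 * r.eval (2 * (n + 2 * N)) + 21)))))))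
    (hdup.bind_silent fun _ T₁ h₁ => ?_) (by omega) fun _ _ _ h => h
  have hcopy : ∀ j k, T₁ (.copy j k) = (M.init (x.map some)).tape k := by
    intro j k
    by_cases hk : k = M.input
    · subst hk
      rw [h₁.1 _ ⟨j, rfl⟩]
      simp [OracleTM.init]
    · rw [h₁.2 _ (by simpa using hk) (by simp), hT _ (by simp)]
      simp [OracleTM.init, hk]
  have hblank : ∀ k, T₁ (.pairing k) = Tape.mk₁ [] := fun k => by
    rw [h₁.2 _ (by simp) (by simp), hT _ (by simp)]
  have hask : T₁ .ask = Tape.mk₁ [] := by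
    rw [h₁.2 _ (by simp) (by simp), hT _ (by simp)]
  clear h₁ hin hT
  refine (runWithoutFirst_ensures (SwapTape.copy_injective 4) rfl O x N T₁ (hcopy 4)
    fun O₀ => hp O₀ x).bind ?_
  rintro l₀ b₀ T₂ ⟨hl₀, hb₀, hF₂⟩
  refine Ensures.bind_silent (simulate_ensures (SwapTape.copy_injective 0) (O₀ := fun _ => ∅)
    (by simp [Consistent]) N (M.init (x.map some)) T₂
    (fun k => by rw [hF₂ _ (by simp), hcopy]) (hp _ x)) ?_
  rintro _ T₃ ⟨c, hc, rfl, hT₃, hF₃⟩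
  -- the outcome of `M`, given that the answer to its query to oracle 0 is known
  have hfirst : ∀ A B Z, M.OrderedQueries ![A, B] → (∀ yes no, M.instr c.state = .query 0 yes no →
      (readBits (c.tape (M.queryTape 0)) ∈ A ↔ readBits (c.tape (M.queryTape 0)) ∈ Z)) →
      ∀ t, M.run ![A, B] (x.map some) t = M.run ![Z, B] (x.map some) t := by
    intro A B Z hord hZ
    refine run_congr_of_stopsAt (a := fun _ => none) (j := 0) (by simp [Consistent]) ?_ rfl hc hZ ?_
    · intro i hi
      fin_cases i
      · simp at hi
      · rfl
    · intro s t i hst _ hi hj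
      exact absurd (hord x s t i 0 hst hi hj).2 (by decide)
  -- The promise concerns `A` only; it passes to `Z` because the runs coincide.
  have hone : ∀ A B Z, M.OrderedQueries ![A, B] →
      (∀ t, M.run ![A, B] (x.map some) t = M.run ![Z, B] (x.map some) t) →
      ∀ s t, s < t → M.QueriesAt ![Z, B] x s 1 → M.QueriesAt ![Z, B] x t 1 → False := by
    intro A B Z hord hrun s t hst hi hj
    rw [QueriesAt, ← hrun] at hi hj
    exact absurd (hord x s t 1 1 hst hi hj).1 (by decide)
  -- If the first query is not in `A`, or is not made, `A` may be replaced by `∅`, the guess behind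
  -- `b₀`.
  have hno : ∀ A B, O 0 = B → M.OrderedQueries ![A, B] →
      (∀ yes no, M.instr c.state = .query 0 yes no → readBits (c.tape (M.queryTape 0)) ∉ A) →
      (b₀ = true ↔ M.Accepts ![A, B] x) := by
    rintro A _ rfl hord hA
    have hrun := hfirst A (O 0) ∅ hord fun yes no h => by simp [hA yes no h]
    rw [accepts_congr hrun]
    exact hb₀ (hone A (O 0) ∅ hord hrun)
  split_ifs with hq
  swap
  · refine Ensures.mono (ensures_ret (Post := fun l b _ => l = [] ∧ b = b₀) ⟨rfl, rfl⟩) (by omega) ?_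
    rintro l b T' ⟨rfl, rfl⟩
    refine ⟨by simpa using hl₀.trans (by decide), ?_⟩
    rintro A B rfl hord
    exact hno A B rfl hord fun yes no h => absurd ⟨yes, no, h⟩ hq
  refine Ensures.bind_silent (simulate_ensures (SwapTape.copy_injective 1)
    (consistent_univ (B := ∅) (by simp)) N (M.init (x.map some)) T₃
    (fun k => by rw [hF₃ _ (by simp), hF₂ _ (by simp), hcopy]) (hp _ x)) ?_
  rintro _ T₄ ⟨c₁, hc₁, -, hT₄, hF₄⟩
  refine Ensures.bind_silent (simulate_ensures (SwapTape.copy_injective 2)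
    (consistent_univ (B := Set.univ) (by simp)) N (M.init (x.map some)) T₄
    (fun k => by rw [hF₄ _ (by simp), hF₃ _ (by simp), hF₂ _ (by simp), hcopy]) (hp _ x)) ?_
  rintro _ T₅ ⟨c₂, hc₂, rfl, -, hF₅⟩
  refine Ensures.bind_silent (simulate_ensures (SwapTape.copy_injective 3)
    (consistent_univ (B := ∅) (by simp)) N (M.init (x.map some)) T₅
    (fun k => by rw [hF₅ _ (by simp), hF₄ _ (by simp), hF₃ _ (by simp), hF₂ _ (by simp), hcopy])
    (hp _ x)) ?_
  rintro _ T₆ ⟨c₃, hc₃, rfl, -, hF₆⟩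
  have hu : (readBits (c.tape (M.queryTape 0))).length ≤ n + 2 * N :=
    (hc.fitsIn _).length_readBits_le
  have hv : (readBits (c₁.tape (M.queryTape 1))).length ≤ n + 2 * N :=
    (hc₁.fitsIn _).length_readBits_le
  refine (resolve_ensures hpair hr T₆ (readBits (c.tape (M.queryTape 0)))
    (readBits (c₁.tape (M.queryTape 1))) ?_ ?_ ?_ ?_ _ _ _).mono ?_ ?_
  · rw [hF₆ _ (by simp), hF₅ _ (by simp), hF₄ _ (by simp), hT₃]
  · rw [hF₆ _ (by simp), hF₅ _ (by simp), hT₄]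
  · intro k
    rw [hF₆ _ (by simp), hF₅ _ (by simp), hF₄ _ (by simp), hF₃ _ (by simp), hF₂ _ (by simp), hblank]
  · rw [hF₆ _ (by simp), hF₅ _ (by simp), hF₄ _ (by simp), hF₃ _ (by simp), hF₂ _ (by simp), hask]
  · have := r.eval_le_eval_nat (m := (readBits (c.tape (M.queryTape 0))).length +
      (readBits (c₁.tape (M.queryTape 1))).length) (n := 2 * (n + 2 * N)) (by omega)
    omega
  rintro l b T' ⟨rfl, hb⟩
  refine ⟨by simpa using hl₀.append (List.Sublist.refl [1]), ?_⟩
  rintro A B rfl hord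
  rw [hb A B rfl]
  by_cases hA : readBits (c.tape (M.queryTape 0)) ∈ A
  swap
  · rw [if_neg hA]
    exact hno A B rfl hord fun _ _ _ => hA
  have hrun := hfirst A B Set.univ hord fun _ _ _ => by simp [hA]
  -- With `A` replaced by `Set.univ`, only the answer on `v` matters, so `B` may become `Set.univ`
  -- or `∅`, the oracles of copies 2 and 3. If no second query is made, `v` is whatever the tape
  -- holds, and the replacement is harmless.
  have hsecond : ∀ Z, (readBits (c₁.tape (M.queryTape 1)) ∈ B ↔
      readBits (c₁.tape (M.queryTape 1)) ∈ Z) →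
      (M.Accepts ![A, B] x ↔ M.Accepts ![Set.univ, Z] x) := by
    intro Z hZ
    rw [accepts_congr hrun]
    refine accepts_congr (run_congr_of_stopsAt (a := ![some true, none]) (j := 1)
      (consistent_univ (by simp)) ?_ rfl hc₁ (fun _ _ _ => hZ) ?_)
    · intro i hi
      fin_cases i
      · rfl
      · simp at hi
    · intro s t i hst hi h₁ h₂
      obtain rfl : i = 1 := by
        fin_cases i
        · simp at hi
        · rfl
      exact hone A B Set.univ hord hrun s t hst h₁ h₂
  have hsome : ∀ b : Bool, ∀ i, (![some true, some b] : Fin 2 → Option Bool) i ≠ none := by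
    intro b i
    fin_cases i <;> simp
  rw [if_pos hA]
  by_cases hB : readBits (c₁.tape (M.queryTape 1)) ∈ B
  · rw [if_pos hB, hsecond Set.univ (by simp [hB])]
    exact (accepts_iff_of_stopsAt (consistent_univ (by simp)) hc₂
      (hc₂.1.halted_of_isSome (hsome _))).symm
  · rw [if_neg hB, hsecond ∅ (by simp [hB])]
    exact (accepts_iff_of_stopsAt (consistent_univ (by simp)) hc₃
      (hc₃.1.halted_of_isSome (hsome _))).symm

end Swap

end TapeProgram

theorem theoremt (pair : List Bool → List Bool → List Bool) (hpair : IsPairing pair)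
    (𝒞 𝒟 : Set (Set (List Bool)))
    (hunion : ClosedUnderDisjUnion 𝒞)
    (hand : Ands pair 𝒞 𝒟)
    (hand_co : Ands pair 𝒞 (coClass 𝒟)) :
    POrdered 𝒞 𝒟 ⊆ POrdered 𝒟 𝒞 := by
  rintro L ⟨A, hA, B, hB, M, ⟨p, hp⟩, hord, hL⟩
  obtain ⟨P, out, r, hr⟩ := hpair.polyTime
  have := M.finK
  have := P.finK
  have hBc : langProd pair A Bᶜ ∈ 𝒞 := hand_co A hA Bᶜ (by simpa [coClass] using hB)
  have key : ∀ O x, (TapeProgram.swap M P out).Ensures (TapeProgram.swapQueryTape M P) O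
      (((TapeProgram.swap M P out).toMachine .input (TapeProgram.swapQueryTape M P)).init
        (List.map some x)).tape ((TapeProgram.swapTime p r).eval x.length) fun l b _ =>
      l.Sublist [0, 1] ∧ ∀ A B, O = ![B, swapLang pair A B] → M.OrderedQueries ![A, B] →
        (b = true ↔ M.Accepts ![A, B] x) := fun O x =>
    TapeProgram.swap_ensures hpair.injective hp hr x _
      (if_pos rfl) fun k hk => if_neg hk
  refine ⟨B, hB, swapLang pair A B, hunion _ (hunion _ hA _ (hand _ hA _ hB)) _
    (hunion _ hBc _ hBc), (TapeProgram.swap M P out).toMachine .input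
    (TapeProgram.swapQueryTape M P), ?_, ?_, fun x => ?_⟩
  · exact TapeProgram.polyTime_toMachine _ fun O x => (key O x).mono le_rfl fun _ _ _ _ => trivial
  · exact TapeProgram.orderedQueries_toMachine fun x =>
      ⟨_, (key _ x).mono le_rfl fun _ _ _ h => h.1⟩
  · rw [hL, TapeProgram.accepts_toMachine_iff
      ((key _ x).mono le_rfl fun _ _ _ h => h.2 A B rfl hord)]
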